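/- For $z=x+i\xi\in\mathbb{C}$ and $g:\mathbb{R}\to\mathbb{C}$ put $\pi(z)g(t)=e^{2\pi i\xi t}g(t-x)$, and for $f,g\in L^2(\mathbb{R})$ let $V_gf(z)=\langle f,\pi(z)g\rangle=\int_{\mathbb{R}}f(t)\overline{g(t-x)}e^{-2\pi i\xi t}\,dt$ be the short-time Fourier transform. Let $Q_R=\{x+i\xi\in\mathbb{C}:\max(|x|,|\xi|)\le R/2\}$. A measurable set $\Omega\subset\mathbb{C}$ is called $(\gamma,R)$-dense if $$\gamma=\inf_{z\in\mathbb{C}}\frac{|\Omega\cap(z+Q_R)|}{R^2}>0 .$$ It is called a planar set of sampling (for $g$) if there is a constant $C>0$ with $$\int_{\mathbb{C}}|V_gf(z)|^2\,dz\le C\int_{\Omega}|V_gf(z)|^2\,dz\qquad\text{for all } f\in L^2(\mathbb{R});$$ the infimum $C(\Omega)$ of these $C$ is its sampling constant. A set $\Gamma\subset\mathbb{C}$ is uniformly separated if the distances between its distinct points are bounded below by a positive constant, and relatively uniformly separated if it is a finite union of uniformly separated sets. Let $0\neq g\in L^2(\mathbb{R})$ be such that every relatively uniformly separated $\Gamma\subset\mathbb{C}$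 generates a Gabor Bessel sequence, i.e. there is $B>0$ with $\sum_{z\in\Gamma}|\langle f,\pi(z)g\rangle|^2\le B\|f\|_2^2$ for all $f\in L^2(\mathbb{R})$. Let $R>2$ be such that every $(\gamma,R)$-dense set, for every $\gamma>0$, is a planar set of sampling for $g$. Then there is no constant $K>0$ such that $C(\Omega)\le K\gamma^{-1}$ for all $\gamma>0$ and all $(\gamma,R)$-dense sets $\Omega$. In particular, for every $K>0$ and every $\delta>0$ there are $\gamma\in(0,\delta)$, a $(\gamma,R)$-dense set $\Omega$ and $\varepsilon>0$ (depending on $K$, $\delta$ and $\Omega$) such that $C(\Omega)\ge K\gamma^{-1-\varepsilon}$. -/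

import Mathlib

noncomputable section

namespace PlanarSampling

open MeasureTheory
open scoped ENNReal ComplexConjugate

/-- The Hilbert space `L²(ℝ)` of complex-valued functions. -/
abbrev L2 : Type := Lp ℂ 2 (volume : Measure ℝ)

/-- The time-frequency shift `π(z)g(t) = e^{2πiξt} g(t - x)`, where `z = x + iξ`. -/
def timeFreqShift (z : ℂ) (g : ℝ → ℂ) : ℝ → ℂ := fun t =>
  Complex.exp (2 * Real.pi * Complex.I * z.im * t) * g (t - z.re)

/-- The short-time Fourier transform `V_g f(z) = ⟨f, π(z)g⟩` (linear in `f`). -/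
def stft (g f : L2) (z : ℂ) : ℂ :=
  ∫ t : ℝ, f t * conj (timeFreqShift z g t)

/-- The closed square `Q_R` of side length `R`, centred at the origin. -/
def square (R : ℝ) : Set ℂ := {w | max |w.re| |w.im| ≤ R / 2}

/-- `Ω` is `(γ, R)`-dense: `Ω` is measurable and
`γ = inf_z |Ω ∩ (z + Q_R)| / R²` is positive. -/
def IsGammaDense (γ R : ℝ) (Ω : Set ℂ) : Prop :=
  MeasurableSet Ω ∧
    γ = ⨅ z : ℂ, (volume : Measure ℂ).real (Ω ∩ (fun w => z + w) '' square R) / R ^ 2 ∧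
    0 < γ

/-- `C` is a sampling bound of `Ω` for the window `g`:
`∫_ℂ |V_g f|² ≤ C ∫_Ω |V_g f|²` for all `f ∈ L²(ℝ)`. -/
def IsSamplingBound (g : L2) (Ω : Set ℂ) (C : ℝ) : Prop :=
  ∀ f : L2, ∫⁻ z : ℂ, ‖stft g f z‖ₑ ^ 2 ≤
    ENNReal.ofReal C * ∫⁻ z in Ω, ‖stft g f z‖ₑ ^ 2

/-- `Ω` is a planar set of sampling for the window `g`. -/
def IsPlanarSamplingSet (g : L2) (Ω : Set ℂ) : Prop :=
  ∃ C : ℝ, 0 < C ∧ IsSamplingBound g Ω C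

/-- The sampling constant of a planar set of sampling: the infimum of its sampling bounds. -/
def samplingConstant (g : L2) (Ω : Set ℂ) : ℝ :=
  sInf {C : ℝ | 0 < C ∧ IsSamplingBound g Ω C}

/-- Distinct points of `Γ` have distance bounded below by a positive constant. -/
def IsUniformlySeparated (Γ : Set ℂ) : Prop :=
  ∃ δ : ℝ, 0 < δ ∧ Γ.Pairwise fun z y => δ ≤ dist z y

/-- `Γ` is a finite union of uniformly separated sets. -/
def IsRelativelyUniformlySeparated (Γ : Set ℂ) : Prop :=
  ∃ (n : ℕ) (s : Fin n → Set ℂ), (∀ i, IsUniformlySeparated (s i)) ∧ Γ = ⋃ i, s i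

/-- `{π(z)g}_{z ∈ Γ}` is a Gabor Bessel sequence:
`∑_{z ∈ Γ} |⟨f, π(z)g⟩|² ≤ B ‖f‖²` for all `f ∈ L²(ℝ)`. -/
def IsGaborBessel (g : L2) (Γ : Set ℂ) : Prop :=
  ∃ B : ℝ, 0 < B ∧ ∀ f : L2,
    ∑' z : Γ, ‖stft g f z‖ₑ ^ 2 ≤ ENNReal.ofReal (B * ‖f‖ ^ 2)

end PlanarSampling

end

/-!
For `a, b > 0` with `ab > 1`, the Gabor system of `g` over the lattice `aℤ + ibℤ` is a Bessel
sequence but not a frame. If it were one, with frame operator `S`, then the Wexler–Raz identity for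
the dual window `S⁻¹g` would give `⟨g, S⁻¹g⟩ = ab`, whereas `|⟨g, S⁻¹g⟩| ≤ 1` holds for every frame.
Hence some `f` has arbitrarily small lattice samples relative to its norm, and by continuity so have
its time-frequency shifts by all small `w`. Integrating over `w ∈ [0, r]²`, the energy of `V_g f` on
the union `Ω_r` of the lattice translates of `[0, r]²` is at most `ε r² ‖f‖²`, while its total
energy is `‖f‖² ‖g‖²` by Moyal's identity. So `r² C(Ω_r) → ∞` as `r → 0`, although the density of
`Ω_r` at a scale `R > max(a, b)` is at least `r² / R²`.
-/

noncomputable section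

namespace PlanarSampling

open Filter MeasureTheory
open scoped ComplexConjugate Convolution ENNReal FourierTransform InnerProductSpace lp NNReal
  Topology

section Frames

variable {𝕜 H ι : Type*} [RCLike 𝕜] [NormedAddCommGroup H] [InnerProductSpace 𝕜 H] {e : ι → H}

variable (𝕜) in
/-- The family `e` is a Bessel sequence: `∑ |⟨e i, f⟩|² ≤ B ‖f‖²`. The inequality is stated in
`ℝ≥0∞`, so that it includes the convergence of the series. -/
def IsBessel (e : ι → H) : Prop :=
  ∃ B : ℝ≥0, ∀ f : H, ∑' i, ‖⟪e i, f⟫_𝕜‖ₑ ^ 2 ≤ B * ‖f‖ₑ ^ 2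

theorem IsBessel.memℓp_inner (he : IsBessel 𝕜 e) (f : H) : Memℓp (fun i => ⟪e i, f⟫_𝕜) 2 := by
  obtain ⟨B, hB⟩ := he
  have hfin : ∑' i, ‖⟪e i, f⟫_𝕜‖ₑ ^ 2 ≠ ∞ := ((hB f).trans_lt (by finiteness)).ne
  refine memℓp_gen ((ENNReal.summable_toReal hfin).congr fun i => ?_)
  simp

theorem enorm_sq_lp_two (x : ℓ²(ι, 𝕜)) : ‖x‖ₑ ^ 2 = ∑' i, ‖x i‖ₑ ^ 2 := by
  have hsum : Summable fun i => ‖x i‖ ^ 2 := by simpa using (lp.memℓp x).summable (by simp)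
  have hnorm : ‖x‖ ^ 2 = ∑' i, ‖x i‖ ^ 2 := by
    simpa using lp.norm_rpow_eq_tsum (p := 2) (by simp) x
  simp_rw [← ofReal_norm, ← ENNReal.ofReal_pow (norm_nonneg _)]
  rw [hnorm, ENNReal.ofReal_tsum_of_nonneg (fun i => by positivity) hsum]

/-- The analysis operator `f ↦ (⟨e i, f⟩)ᵢ` of a Bessel sequence. -/
def IsBessel.analysis (he : IsBessel 𝕜 e) : H →L[𝕜] ℓ²(ι, 𝕜) :=
  let T : H →ₗ[𝕜] ℓ²(ι, 𝕜) :=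
    { toFun f := ⟨fun i => ⟪e i, f⟫_𝕜, he.memℓp_inner f⟩
      map_add' f h := by ext i; exact inner_add_right _ _ _
      map_smul' c f := by ext i; exact inner_smul_right _ _ _ }
  have hT : ∃ C : ℝ, ∀ f, ‖T f‖ ≤ C * ‖f‖ := by
    obtain ⟨B, hB⟩ := he
    refine ⟨NNReal.sqrt B, fun f => ?_⟩
    have h : ‖T f‖ₑ ^ 2 ≤ ((NNReal.sqrt B : ℝ≥0) * ‖f‖ₑ) ^ 2 := by
      rw [enorm_sq_lp_two, mul_pow, ← ENNReal.coe_pow, NNReal.sq_sqrt]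
      exact hB f
    have h' : ‖T f‖ₑ ≤ (NNReal.sqrt B * ‖f‖₊ : ℝ≥0) :=
      (ENNReal.pow_le_pow_left_iff two_ne_zero).1 h
    exact NNReal.coe_le_coe.2 (ENNReal.coe_le_coe.1 h')
  T.mkContinuousOfExistsBound hT

@[simp]
theorem IsBessel.analysis_apply (he : IsBessel 𝕜 e) (f : H) (i : ι) :
    he.analysis f i = ⟪e i, f⟫_𝕜 := rfl

theorem IsBessel.enorm_sq_analysis (he : IsBessel 𝕜 e) (f : H) :
    ‖he.analysis f‖ₑ ^ 2 = ∑' i, ‖⟪e i, f⟫_𝕜‖ₑ ^ 2 :=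
  enorm_sq_lp_two _

variable [CompleteSpace H]

theorem IsBessel.adjoint_analysis_single [DecidableEq ι] (he : IsBessel 𝕜 e) (i : ι) (c : 𝕜) :
    he.analysis.adjoint (lp.single 2 i c) = c • e i := by
  refine ext_inner_right 𝕜 fun h => ?_
  rw [ContinuousLinearMap.adjoint_inner_left, lp.inner_single_left, inner_smul_left,
    he.analysis_apply, RCLike.inner_apply, mul_comm]

/-- The frame operator `f ↦ ∑ ⟨e i, f⟩ e i` of a Bessel sequence. -/
def IsBessel.frameOperator (he : IsBessel 𝕜 e) : H →L[𝕜] H :=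
  he.analysis.adjoint ∘L he.analysis

theorem IsBessel.inner_frameOperator_left (he : IsBessel 𝕜 e) (f h : H) :
    ⟪he.frameOperator f, h⟫_𝕜 = ⟪he.analysis f, he.analysis h⟫_𝕜 := by
  rw [frameOperator, ContinuousLinearMap.comp_apply, ContinuousLinearMap.adjoint_inner_left]

theorem IsBessel.hasSum_frameOperator (he : IsBessel 𝕜 e) (f : H) :
    HasSum (fun i => ⟪e i, f⟫_𝕜 • e i) (he.frameOperator f) := by
  classical
  have h := (lp.hasSum_single (p := 2) (by simp) (he.analysis f)).mapL he.analysis.adjoint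
  simp only [he.adjoint_analysis_single, he.analysis_apply] at h
  exact h

theorem IsBessel.isUnit_frameOperator (he : IsBessel 𝕜 e) {A : ℝ} (hA : 0 < A)
    (hlow : ∀ f, A * ‖f‖ ^ 2 ≤ ‖he.analysis f‖ ^ 2) : IsUnit he.frameOperator := by
  refine ContinuousLinearMap.isUnit_of_forall_le_norm_inner_map _ (c := ⟨A, hA.le⟩) hA fun f => ?_
  rw [he.inner_frameOperator_left, inner_self_eq_norm_sq_to_K, norm_pow, RCLike.norm_ofReal,
    abs_norm, mul_comm]
  exact hlow f

theorem IsBessel.commute_frameOperator (he : IsBessel 𝕜 e) (U : H →ₗᵢ[𝕜] H) (σ : ι ≃ ι)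
    (c : ι → 𝕜) (hc : ∀ i, ‖c i‖ = 1) (hU : ∀ i, U (e i) = c i • e (σ i)) :
    Commute he.frameOperator U.toContinuousLinearMap := by
  ext f
  have h₁ : HasSum (fun i => ⟪e (σ i), U f⟫_𝕜 • e (σ i)) (he.frameOperator (U f)) :=
    σ.hasSum_iff.2 (he.hasSum_frameOperator (U f))
  have hterm (i : ι) : U (⟪e i, f⟫_𝕜 • e i) = ⟪e (σ i), U f⟫_𝕜 • e (σ i) := by
    rw [map_smul, ← U.inner_map_map, hU, inner_smul_left, smul_smul, mul_right_comm,
      RCLike.conj_mul, hc]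
    simp
  have h₂ := (he.hasSum_frameOperator f).mapL U.toContinuousLinearMap
  simp only [LinearIsometry.coe_toContinuousLinearMap, hterm] at h₂
  exact h₁.unique h₂

section Dual

variable (he : IsBessel 𝕜 e) (hS : IsUnit he.frameOperator)

include hS in
theorem IsBessel.hasSum_inverse_frameOperator (f : H) :
    HasSum (fun i => ⟪e i, f⟫_𝕜 • Ring.inverse he.frameOperator (e i)) f := by
  have h := (he.hasSum_frameOperator f).mapL (Ring.inverse he.frameOperator)
  rw [← mul_apply_eq_comp, Ring.inverse_mul_cancel _ hS] at h
  simpa using h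

include hS in
theorem IsBessel.norm_inner_inverse_frameOperator_le_one (i : ι) :
    ‖⟪e i, Ring.inverse he.frameOperator (e i)⟫_𝕜‖ ≤ 1 := by
  set x := Ring.inverse he.frameOperator (e i)
  have hx : he.frameOperator x = e i := by
    rw [← mul_apply_eq_comp, Ring.mul_inverse_cancel _ hS, one_apply_eq_self]
  have heq : ‖⟪e i, x⟫_𝕜‖ = ‖he.analysis x‖ ^ 2 := by
    rw [← hx, he.inner_frameOperator_left, inner_self_eq_norm_sq_to_K]
    simp
  have hle : ‖⟪e i, x⟫_𝕜‖ ≤ ‖he.analysis x‖ := lp.norm_apply_le_norm (by simp) (he.analysis x) i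
  nlinarith [norm_nonneg (he.analysis x)]

end Dual

end Frames

theorem continuous_of_continuous_inner {𝕜 H X : Type*} [RCLike 𝕜] [NormedAddCommGroup H]
    [InnerProductSpace 𝕜 H] [TopologicalSpace X] {u : X → H} {c : ℝ} (hnorm : ∀ x, ‖u x‖ = c)
    (hinner : ∀ f, Continuous fun x => ⟪u x, f⟫_𝕜) : Continuous u := by
  refine continuous_iff_continuousAt.2 fun x₀ => tendsto_iff_norm_sub_tendsto_zero.2 ?_
  have hsq : Tendsto (fun x => ‖u x - u x₀‖ ^ 2) (𝓝 x₀) (𝓝 0) := by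
    simp only [@norm_sub_sq 𝕜, hnorm]
    have h : Continuous fun x => c ^ 2 - 2 * RCLike.re ⟪u x, u x₀⟫_𝕜 + c ^ 2 := by
      have := hinner (u x₀)
      fun_prop
    refine (h.tendsto x₀).trans_eq ?_
    rw [inner_self_eq_norm_sq, hnorm]
    ring_nf
  simpa using hsq.sqrt

section TimeFrequencyShifts

theorem norm_exp_two_pi_I_mul (x y : ℝ) :
    ‖Complex.exp (2 * Real.pi * Complex.I * x * y)‖ = 1 := by
  have h : (2 * Real.pi * Complex.I * x * y : ℂ) = (2 * Real.pi * x * y : ℝ) * Complex.I := by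
    push_cast; ring
  rw [h, Complex.norm_exp_ofReal_mul_I]

theorem norm_timeFreqShift (z : ℂ) (g : ℝ → ℂ) (t : ℝ) :
    ‖timeFreqShift z g t‖ = ‖g (t - z.re)‖ := by
  rw [timeFreqShift, norm_mul, norm_exp_two_pi_I_mul, one_mul]

theorem timeFreqShift_congr_ae (z : ℂ) {g h : ℝ → ℂ} (hgh : g =ᵐ[volume] h) :
    timeFreqShift z g =ᵐ[volume] timeFreqShift z h := by
  filter_upwards [(measurePreserving_sub_right volume z.re).quasiMeasurePreserving.ae_eq_comp hgh]
    with t ht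
  rw [timeFreqShift, timeFreqShift, show g (t - z.re) = h (t - z.re) from ht]

theorem timeFreqShift_timeFreqShift (z w : ℂ) (g : ℝ → ℂ) (t : ℝ) :
    timeFreqShift z (timeFreqShift w g) t =
      Complex.exp (2 * Real.pi * Complex.I * w.im * (-z.re : ℝ)) * timeFreqShift (z + w) g t := by
  simp only [timeFreqShift, ← mul_assoc, ← Complex.exp_add, Complex.add_re, Complex.add_im]
  congr 2
  · push_cast; ring
  · ring

theorem memLp_timeFreqShift (z : ℂ) {g : ℝ → ℂ} {p : ℝ≥0∞} (hg : MemLp g p volume) :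
    MemLp (timeFreqShift z g) p volume := by
  have hg' : MemLp (fun t => g (t - z.re)) p volume :=
    hg.comp_measurePreserving (measurePreserving_sub_right volume z.re)
  refine hg'.of_le (.mul ?_ hg'.aestronglyMeasurable)
    (ae_of_all _ fun t => (norm_timeFreqShift z g t).le)
  exact Continuous.aestronglyMeasurable (by fun_prop)

/-- The time-frequency shift `π(z)` as a linear isometry of `L²(ℝ)`. -/
def shiftL2 (z : ℂ) : L2 →ₗᵢ[ℂ] L2 where
  toFun f := (memLp_timeFreqShift z (Lp.memLp f)).toLp _
  map_add' f h := by
    rw [← MemLp.toLp_add]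
    refine MemLp.toLp_congr _ _ ((timeFreqShift_congr_ae z (Lp.coeFn_add f h)).trans ?_)
    exact ae_of_all _ fun t => by simp [timeFreqShift, mul_add]
  map_smul' c f := by
    rw [RingHom.id_apply, ← MemLp.toLp_const_smul]
    refine MemLp.toLp_congr _ _ ((timeFreqShift_congr_ae z (Lp.coeFn_smul c f)).trans ?_)
    exact ae_of_all _ fun t => by simp [timeFreqShift, mul_left_comm]
  norm_map' f := by
    change ‖(memLp_timeFreqShift z (Lp.memLp f)).toLp (timeFreqShift z f)‖ = ‖f‖
    rw [Lp.norm_toLp, Lp.norm_def, ← eLpNorm_comp_measurePreserving (Lp.aestronglyMeasurable f)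
      (measurePreserving_sub_right volume z.re)]
    exact congrArg _ (eLpNorm_congr_norm_ae (ae_of_all _ fun t => norm_timeFreqShift z f t))

theorem coeFn_shiftL2 (z : ℂ) (f : L2) : shiftL2 z f =ᵐ[volume] timeFreqShift z f :=
  (memLp_timeFreqShift z (Lp.memLp f)).coeFn_toLp

theorem shiftL2_shiftL2 (z w : ℂ) (g : L2) :
    shiftL2 z (shiftL2 w g) =
      Complex.exp (2 * Real.pi * Complex.I * w.im * (-z.re : ℝ)) • shiftL2 (z + w) g := by
  refine Lp.ext ?_
  filter_upwards [coeFn_shiftL2 z (shiftL2 w g), timeFreqShift_congr_ae z (coeFn_shiftL2 w g),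
    coeFn_shiftL2 (z + w) g, Lp.coeFn_smul
      (Complex.exp (2 * Real.pi * Complex.I * w.im * (-z.re : ℝ))) (shiftL2 (z + w) g)]
    with t h₁ h₂ h₃ h₄
  rw [h₁, h₂, h₄, Pi.smul_apply, h₃, timeFreqShift_timeFreqShift, smul_eq_mul]

theorem shiftL2_zero (g : L2) : shiftL2 0 g = g := by
  refine Lp.ext ?_
  filter_upwards [coeFn_shiftL2 0 g] with t ht
  simp [ht, timeFreqShift]

theorem stft_eq_inner (g f : L2) (z : ℂ) : stft g f z = ⟪shiftL2 z g, f⟫_ℂ := by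
  rw [L2.inner_def, stft]
  refine integral_congr_ae ?_
  filter_upwards [coeFn_shiftL2 z g] with t ht
  rw [RCLike.inner_apply, ht]

theorem enorm_stft_add (g f : L2) (z w : ℂ) :
    ‖stft g f (z + w)‖ₑ = ‖⟪shiftL2 z g, shiftL2 (-w) f⟫_ℂ‖ₑ := by
  have h := shiftL2_shiftL2 (-w) (z + w) g
  rw [neg_add_cancel_comm_assoc] at h
  rw [stft_eq_inner, ← (shiftL2 (-w)).inner_map_map, h, inner_smul_left, enorm_mul,
    RCLike.enorm_conj, ← ofReal_norm, norm_exp_two_pi_I_mul, ENNReal.ofReal_one, one_mul]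

theorem stft_eq_fourier (g f : L2) (x ξ : ℝ) :
    stft g f ⟨x, ξ⟩ = 𝓕 (fun t => f t * conj (g (t - x))) ξ := by
  rw [Real.fourier_real_eq_integral_exp_smul, stft]
  refine integral_congr_ae (ae_of_all _ fun t => ?_)
  simp only [timeFreqShift, map_mul, ← Complex.exp_conj, Complex.conj_ofReal, Complex.conj_I,
    map_ofNat, smul_eq_mul]
  rw [mul_left_comm]
  congr 2
  push_cast
  ring

theorem memLp_translate (g : L2) (y : ℝ) : MemLp (fun t => g (t - y)) 2 volume :=
  (Lp.memLp g).comp_measurePreserving (measurePreserving_sub_right volume y)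

theorem integrable_mul_conj_translate (g f : L2) (x : ℝ) :
    Integrable fun t => f t * conj (g (t - x)) :=
  (Lp.memLp f).integrable_mul (memLp_translate g x).star

theorem continuous_stft_vertical (g f : L2) (x : ℝ) : Continuous fun ξ : ℝ => stft g f ⟨x, ξ⟩ := by
  simp only [stft_eq_fourier]
  exact VectorFourier.fourierIntegral_continuous Real.continuous_fourierChar
    (innerSL ℝ).continuous₂ (integrable_mul_conj_translate g f x)

theorem continuous_shiftL2_modulation (g : L2) : Continuous fun ξ : ℝ => shiftL2 ⟨0, ξ⟩ g := by
  refine continuous_of_continuous_inner (𝕜 := ℂ) (fun ξ => (shiftL2 ⟨0, ξ⟩).norm_map g) fun f => ?_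
  simpa only [← stft_eq_inner] using continuous_stft_vertical g f 0

theorem continuous_shiftL2_translation (g : L2) : Continuous fun x : ℝ => shiftL2 x g := by
  let τ (x : ℝ) : C(ℝ, ℝ) := ⟨fun t => t - x, by fun_prop⟩
  have hτ : Continuous τ :=
    ContinuousMap.continuous_of_continuous_uncurry _ (continuous_snd.sub continuous_fst)
  convert continuous_const.compMeasurePreservingLp hτ
    (fun x => measurePreserving_sub_right volume x) (f := fun _ => g) ENNReal.ofNat_ne_top
    using 2 with x
  refine Lp.ext ?_
  filter_upwards [coeFn_shiftL2 x g, Lp.coeFn_compMeasurePreserving g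
    (measurePreserving_sub_right volume x)] with t h₁ h₂
  rw [h₁]
  refine Eq.trans ?_ h₂.symm
  simp [timeFreqShift]

theorem continuous_shiftL2 (g : L2) : Continuous fun z : ℂ => shiftL2 z g := by
  have hcont : Continuous fun p : ℝ × L2 => shiftL2 ⟨0, p.1⟩ p.2 :=
    continuous_prod_of_continuous_lipschitzWith' _ 1 (fun ξ => (shiftL2 ⟨0, ξ⟩).lipschitz)
      continuous_shiftL2_modulation
  have heq (z : ℂ) : shiftL2 ⟨0, z.im⟩ (shiftL2 z.re g) = shiftL2 z g := by
    rw [shiftL2_shiftL2]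
    have : (⟨0, z.im⟩ + (z.re : ℂ) : ℂ) = z := by apply Complex.ext <;> simp
    simp [this]
  simpa only [Function.comp_def, heq] using hcont.comp
    (Complex.continuous_im.prodMk ((continuous_shiftL2_translation g).comp Complex.continuous_re))

theorem continuous_stft (g f : L2) : Continuous (stft g f) := by
  simp only [funext (stft_eq_inner g f)]
  exact (continuous_shiftL2 g).inner continuous_const

end TimeFrequencyShifts

section Averaging

variable {E : Type*} [NormedAddCommGroup E] [NormedSpace ℝ E]

theorem intervalIntegral_eq_convolution (h : ℝ → E) {T : ℝ} (hT : 0 ≤ T) (c : ℝ) :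
    ∫ t in c..c + T, h t =
      ((Set.Ioc (-T) 0).indicator 1 ⋆[ContinuousLinearMap.lsmul ℝ ℝ, volume] h) c := by
  have hind (t : ℝ) : (Set.Ioc (-T) 0).indicator (1 : ℝ → ℝ) t • h (c - t) =
      (Set.Ioc (-T) 0).indicator (fun t => h (c - t)) t := by
    by_cases ht : t ∈ Set.Ioc (-T) 0 <;> simp [ht]
  simp only [convolution_lsmul, hind]
  rw [integral_indicator measurableSet_Ioc, ← intervalIntegral.integral_of_le (by linarith),
    intervalIntegral.integral_comp_sub_left, sub_zero, sub_neg_eq_add]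

theorem integrable_indicator_Ioc_one (c d : ℝ) :
    Integrable ((Set.Ioc c d).indicator (1 : ℝ → ℝ)) :=
  (integrable_indicator_iff measurableSet_Ioc).2 (integrableOn_const (by simp))

theorem integrable_intervalIntegral_translate {h : ℝ → E} (hh : Integrable h) {T : ℝ}
    (hT : 0 ≤ T) : Integrable fun c => ∫ t in c..c + T, h t := by
  simp only [intervalIntegral_eq_convolution h hT]
  exact (integrable_indicator_Ioc_one _ _).integrable_convolution _ hh

theorem integral_intervalIntegral_translate [CompleteSpace E] {h : ℝ → E} (hh : Integrable h)
    {T : ℝ} (hT : 0 ≤ T) : ∫ c, ∫ t in c..c + T, h t = T • ∫ t, h t := by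
  simp only [intervalIntegral_eq_convolution h hT]
  rw [integral_convolution _ (integrable_indicator_Ioc_one _ _) hh]
  simp [integral_indicator measurableSet_Ioc, hT]

theorem hasSum_integral_translates {φ : ℝ → E} (hφ : Integrable φ) {a : ℝ} (ha : 0 < a) :
    HasSum (fun k : ℤ => ∫ c in (0 : ℝ)..a, φ (c + k • a)) (∫ c, φ c) := by
  have h := hasSum_integral_iUnion (f := φ) (fun _ : ℤ => measurableSet_Ioc)
    (Set.pairwise_disjoint_Ioc_add_zsmul (0 : ℝ) a) hφ.integrableOn
  rw [iUnion_Ioc_add_zsmul ha, setIntegral_univ] at h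
  convert h using 2 with k
  rw [intervalIntegral.integral_comp_add_right, intervalIntegral.integral_of_le (by linarith),
    add_zsmul, one_zsmul, zero_add, zero_add, add_comm a]

theorem integral_eq_smul_of_hasSum_translates [CompleteSpace E] {φ : ℝ → E} (hφ : Integrable φ)
    {a : ℝ} (ha : 0 < a) {y : E} (hsum : ∀ c, HasSum (fun k : ℤ => φ (c + k • a)) y) :
    ∫ c, φ c = a • y := by
  have hint := hasSum_integral_translates hφ ha
  have hnorm := (hasSum_integral_translates hφ.norm ha).summable
  simp only [intervalIntegral.integral_of_le ha.le] at hint hnorm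
  have hswap := hasSum_integral_of_summable_integral_norm
    (fun k : ℤ => (hφ.comp_add_right (k • a)).integrableOn) hnorm
  simp only [(hsum _).tsum_eq, setIntegral_const, Real.volume_real_Ioc_of_le ha.le, sub_zero]
    at hswap
  exact hint.unique hswap

end Averaging

section GaborDuality

theorem hasSum_conj_fourierCoeffOn_mul {c d : ℝ} {u v : ℝ → ℂ} (hcd : c < d)
    (hu : MemLp u 2 (volume.restrict (Set.Ioc c d)))
    (hv : MemLp v 2 (volume.restrict (Set.Ioc c d))) :
    HasSum (fun n => conj (fourierCoeffOn hcd u n) * fourierCoeffOn hcd v n)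
      ((d - c)⁻¹ • ∫ t in c..d, conj (u t) * v t) := by
  have := Fact.mk (sub_pos.2 hcd)
  rw [← add_sub_cancel c d] at hu hv
  have hu' := hu.memLp_liftIoc.haarAddCircle
  have hv' := hv.memLp_liftIoc.haarAddCircle
  convert fourierBasis.hasSum_inner_mul_inner hu'.toLp hv'.toLp using 1
  · rfl
  · funext n
    rw [← inner_conj_symm, ← fourierBasis.repr_apply_apply, ← fourierBasis.repr_apply_apply,
      fourierBasis_repr, fourierBasis_repr, fourierCoeff_congr_ae hu'.coeFn_toLp,
      fourierCoeff_congr_ae hv'.coeFn_toLp]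
    simp [fourierCoeff_liftIoc_eq]
  · nth_rw 2 [← add_sub_cancel c d]
    rw [← AddCircle.integral_liftIoc_eq_intervalIntegral, L2.inner_def,
      ← AddCircle.integral_haarAddCircle]
    refine integral_congr_ae ?_
    filter_upwards [hu'.coeFn_toLp, hv'.coeFn_toLp] with x hx hy
    rw [hx, hy, RCLike.inner_apply, mul_comm]
    rfl

variable {a b : ℝ}

/-- The points of the lattice `aℤ + ibℤ`. -/
def latticePoint (a b : ℝ) (p : ℤ × ℤ) : ℂ := ⟨a * p.1, b * p.2⟩

theorem latticePoint_add (p q : ℤ × ℤ) :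
    latticePoint a b (p + q) = latticePoint a b p + latticePoint a b q := by
  apply Complex.ext <;> simp [latticePoint, mul_add]

theorem latticePoint_zero : latticePoint a b 0 = 0 := by
  apply Complex.ext <;> simp [latticePoint]

/-- The Gabor system with window `g` over the lattice `aℤ + ibℤ`. -/
def gaborSystem (a b : ℝ) (g : L2) (p : ℤ × ℤ) : L2 := shiftL2 (latticePoint a b p) g

theorem gaborSystem_zero (g : L2) : gaborSystem a b g 0 = g := by
  rw [gaborSystem, latticePoint_zero, shiftL2_zero]

theorem shiftL2_gaborSystem (g : L2) (p q : ℤ × ℤ) :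
    shiftL2 (latticePoint a b p) (gaborSystem a b g q) =
      Complex.exp (2 * Real.pi * Complex.I * (latticePoint a b q).im *
        (-(latticePoint a b p).re : ℝ)) • gaborSystem a b g (p + q) := by
  rw [gaborSystem, gaborSystem, shiftL2_shiftL2, latticePoint_add]

/-- The window `x` is dual to `g` on the lattice `aℤ + ibℤ`: every `f` is the sum of the series
`∑ ⟨f, π(λ)g⟩ π(λ)x` over the points `λ` of the lattice. -/
def IsDualWindow (a b : ℝ) (g x : L2) : Prop :=
  ∀ f, HasSum (fun p => ⟪gaborSystem a b g p, f⟫_ℂ • gaborSystem a b x p) f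

theorem isDualWindow_inverse_frameOperator {g : L2} (hg : IsBessel ℂ (gaborSystem a b g))
    (hS : IsUnit hg.frameOperator) :
    IsDualWindow a b g (Ring.inverse hg.frameOperator g) := by
  intro f
  convert hg.hasSum_inverse_frameOperator hS f using 3 with p
  set U := (shiftL2 (latticePoint a b p)).toContinuousLinearMap
  have hcomm : Commute (Ring.inverse hg.frameOperator) U := by
    rw [← hS.unit_spec, Ring.inverse_unit]
    refine Commute.units_inv_left ?_
    rw [hS.unit_spec]
    exact hg.commute_frameOperator _ (Equiv.addLeft p) _ (fun q => norm_exp_two_pi_I_mul _ _)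
      (shiftL2_gaborSystem g p)
  exact (congrArg (· g) hcomm.eq).symm

theorem fourierCoeffOn_add_inv (hb : 0 < b) (c : ℝ) (u : ℝ → ℂ) (n : ℤ) :
    fourierCoeffOn (lt_add_of_pos_right c (inv_pos.2 hb)) u (-n) =
      b * ∫ t in Set.Ioc c (c + b⁻¹),
        Complex.exp (2 * Real.pi * Complex.I * (b * n) * t) * u t := by
  rw [fourierCoeffOn_eq_integral, intervalIntegral.integral_of_le (by linarith [inv_pos.2 hb])]
  simp only [add_sub_cancel_left, one_div, inv_inv, fourier_coe_apply, neg_neg, smul_eq_mul,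
    Complex.real_smul]
  congr! 5
  push_cast
  field_simp

theorem setIntegral_gaborSystem (hb : 0 < b) (c : ℝ) (k n : ℤ) (g : L2) :
    ∫ t in Set.Ioc c (c + b⁻¹), gaborSystem a b g (k, n) t =
      (b : ℂ)⁻¹ * fourierCoeffOn (lt_add_of_pos_right c (inv_pos.2 hb))
        (fun t => g (t - a * k)) (-n) := by
  rw [fourierCoeffOn_add_inv hb, inv_mul_cancel_left₀ (Complex.ofReal_ne_zero.2 hb.ne')]
  refine integral_congr_ae (ae_restrict_of_ae ?_)
  filter_upwards [coeFn_shiftL2 (latticePoint a b (k, n)) g] with t ht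
  rw [gaborSystem, ht]
  simp [timeFreqShift, latticePoint]

/-- The dual window expansion of the indicator of `(c, c + b⁻¹]`, tested against that indicator; the
sum over the modulations is evaluated by Parseval's identity. -/
theorem IsDualWindow.hasSum_intervalIntegral {g x : L2} (hx : IsDualWindow a b g x) (hb : 0 < b)
    (c : ℝ) :
    HasSum (fun k : ℤ => ∫ t in c..c + b⁻¹, conj (g (t - a * k)) * x (t - a * k)) 1 := by
  have hb' : (b : ℂ) ≠ 0 := Complex.ofReal_ne_zero.2 hb.ne'
  have hc := lt_add_of_pos_right c (inv_pos.2 hb)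
  have hE : volume (Set.Ioc c (c + b⁻¹)) ≠ ∞ := by simp
  set f : L2 := indicatorConstLp 2 measurableSet_Ioc hE 1
  have hinner (h : L2) : ⟪f, h⟫_ℂ = ∫ t in Set.Ioc c (c + b⁻¹), h t :=
    L2.inner_indicatorConstLp_one ..
  have hff : ⟪f, f⟫_ℂ = (b : ℂ)⁻¹ := by
    rw [L2.inner_indicatorConstLp_indicatorConstLp]
    simp [hb.le]
  have hsum := (hx f).mapL (innerSL ℂ f)
  simp only [innerSL_apply_apply, inner_smul_right, hff] at hsum
  have hsum' := (hsum.mul_left (b : ℂ))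
  rw [mul_inv_cancel₀ hb'] at hsum'
  refine hsum'.prod_fiberwise fun k => ?_
  have hParseval := hasSum_conj_fourierCoeffOn_mul hc
    ((memLp_translate g (a * k)).restrict _) ((memLp_translate x (a * k)).restrict _)
  rw [← (Equiv.neg ℤ).hasSum_iff] at hParseval
  convert hParseval.mul_left (b : ℂ)⁻¹ using 1
  · funext n
    rw [← inner_conj_symm _ f, hinner, hinner, setIntegral_gaborSystem hb,
      setIntegral_gaborSystem hb]
    simp only [map_mul, map_inv₀, Complex.conj_ofReal, Equiv.neg_apply, Function.comp_apply]
    field_simp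
  · simp [hb']

/-- The Wexler–Raz identity at the origin, obtained by integrating `hasSum_intervalIntegral` over
`c ∈ (0, a]`: the translates add up to `b⁻¹ ⟨g, x⟩`, and the constant `1` becomes `a`. -/
theorem IsDualWindow.inner_eq {g x : L2} (hx : IsDualWindow a b g x) (ha : 0 < a) (hb : 0 < b) :
    ⟪g, x⟫_ℂ = a * b := by
  set h : ℝ → ℂ := fun t => conj (g t) * x t
  have hh : Integrable h := by
    simpa only [RCLike.inner_apply, h, mul_comm (conj _)] using L2.integrable_inner (𝕜 := ℂ) g x
  have hinner : ⟪g, x⟫_ℂ = ∫ t, h t := by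
    simp only [L2.inner_def, RCLike.inner_apply, mul_comm, h]
  have hperiodic (c : ℝ) :
      HasSum (fun k : ℤ => ∫ t in (c + k • a)..(c + k • a) + b⁻¹, h t) 1 := by
    rw [← (Equiv.neg ℤ).hasSum_iff]
    convert hx.hasSum_intervalIntegral hb c using 2 with k
    rw [intervalIntegral.integral_comp_sub_right h]
    simp only [Function.comp_apply, Equiv.neg_apply, zsmul_eq_mul, Int.cast_neg]
    congr 1 <;> ring
  have havg := integral_eq_smul_of_hasSum_translates
    (integrable_intervalIntegral_translate hh (inv_nonneg.2 hb.le)) ha hperiodic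
  rw [integral_intervalIntegral_translate hh (inv_nonneg.2 hb.le),
    inv_smul_eq_iff₀ hb.ne', ← hinner] at havg
  simp [havg, mul_comm]

theorem mul_le_one_of_lower_frame_bound {g : L2} (hg : IsBessel ℂ (gaborSystem a b g))
    (ha : 0 < a) (hb : 0 < b) {A : ℝ} (hA : 0 < A)
    (hlow : ∀ f, A * ‖f‖ ^ 2 ≤ ‖hg.analysis f‖ ^ 2) : a * b ≤ 1 := by
  have hS := hg.isUnit_frameOperator hA hlow
  have hle := hg.norm_inner_inverse_frameOperator_le_one hS 0
  rw [gaborSystem_zero, (isDualWindow_inverse_frameOperator hg hS).inner_eq ha hb] at hle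
  simpa [abs_of_pos ha, abs_of_pos hb] using hle

end GaborDuality

section Moyal

theorem ae_eq_fourier_toLp {V F : Type*} [NormedAddCommGroup V] [InnerProductSpace ℝ V]
    [FiniteDimensional ℝ V] [MeasurableSpace V] [BorelSpace V] [NormedAddCommGroup F]
    [InnerProductSpace ℂ F] [CompleteSpace F] {f : V → F} (hf : Integrable f)
    (hf₂ : MemLp f 2 volume) : (𝓕 (hf₂.toLp f) : Lp F 2 volume) =ᵐ[volume] 𝓕 f := by
  have hcont : Continuous (𝓕 f) := VectorFourier.fourierIntegral_continuous
    Real.continuous_fourierChar (innerSL ℝ).continuous₂ hf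
  refine ae_eq_of_integral_contDiff_smul_eq ((Lp.memLp _).locallyIntegrable one_le_two)
    hcont.locallyIntegrable fun u hu hsupp => ?_
  let v : SchwartzMap V ℂ := (hsupp.comp_left Complex.ofReal_zero).toSchwartzMap
    (Complex.ofRealCLM.contDiff.comp hu)
  have hv (ξ : V) : v ξ = (u ξ : ℂ) := rfl
  calc ∫ ξ, u ξ • (𝓕 (hf₂.toLp f) : Lp F 2 volume) ξ
    _ = Lp.toTemperedDistribution (𝓕 (hf₂.toLp f) : Lp F 2 volume) v := by
        simp only [Lp.toTemperedDistribution_apply, hv, Complex.coe_smul]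
    _ = ∫ x, 𝓕 v x • hf₂.toLp f x := by
        rw [← Lp.fourier_toTemperedDistribution_eq, TemperedDistribution.fourier_apply,
          Lp.toTemperedDistribution_apply]
    _ = ∫ x, 𝓕 v x • f x :=
        integral_congr_ae (hf₂.coeFn_toLp.mono fun x hx => by simp only [hx])
    _ = ∫ ξ, u ξ • 𝓕 f ξ := by
        simp only [SchwartzMap.fourier_coe, ← Complex.coe_smul, ← hv]
        have h := VectorFourier.integral_fourierIntegral_smul_eq_flip (L := innerₗ V)
          Real.continuous_fourierChar continuous_inner (v.integrable (μ := volume)) hf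
        rwa [flip_innerₗ] at h

theorem enorm_sq_Lp_two {α F : Type*} [MeasurableSpace α] {μ : Measure α} [NormedAddCommGroup F]
    (f : Lp F 2 μ) : ‖f‖ₑ ^ 2 = ∫⁻ t, ‖f t‖ₑ ^ 2 ∂μ := by
  rw [Lp.enorm_def]
  simpa using eLpNorm_nnreal_pow_eq_lintegral (p := 2) (f := f) (μ := μ) two_ne_zero

theorem lintegral_enorm_sq_fourier {V F : Type*} [NormedAddCommGroup V] [InnerProductSpace ℝ V]
    [FiniteDimensional ℝ V] [MeasurableSpace V] [BorelSpace V] [NormedAddCommGroup F]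
    [InnerProductSpace ℂ F] [CompleteSpace F] {f : V → F} (hf : Integrable f)
    (hf₂ : MemLp f 2 volume) : ∫⁻ ξ, ‖𝓕 f ξ‖ₑ ^ 2 = ∫⁻ t, ‖f t‖ₑ ^ 2 := by
  calc ∫⁻ ξ, ‖𝓕 f ξ‖ₑ ^ 2
    _ = ‖(𝓕 (hf₂.toLp f) : Lp F 2 volume)‖ₑ ^ 2 := by
        rw [enorm_sq_Lp_two]
        exact lintegral_congr_ae ((ae_eq_fourier_toLp hf hf₂).mono fun ξ hξ => by simp only [hξ])
    _ = ‖hf₂.toLp f‖ₑ ^ 2 := by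
        rw [← ofReal_norm, Lp.norm_fourier_eq, ofReal_norm]
    _ = ∫⁻ t, ‖f t‖ₑ ^ 2 := by
        rw [enorm_sq_Lp_two]
        exact lintegral_congr_ae (hf₂.coeFn_toLp.mono fun t ht => by simp only [ht])

theorem lintegral_lintegral_enorm_sq_mul_conj_translate (g f : L2) :
    ∫⁻ x : ℝ, ∫⁻ t : ℝ, ‖f t * conj (g (t - x))‖ₑ ^ 2 = ‖f‖ₑ ^ 2 * ‖g‖ₑ ^ 2 := by
  have hf := (Lp.stronglyMeasurable f).measurable
  have hg := (Lp.stronglyMeasurable g).measurable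
  simp only [enorm_mul, RCLike.enorm_conj, mul_pow]
  rw [lintegral_lintegral_swap (by fun_prop)]
  have hinner (t : ℝ) : ∫⁻ x : ℝ, ‖f t‖ₑ ^ 2 * ‖g (t - x)‖ₑ ^ 2 = ‖f t‖ₑ ^ 2 * ‖g‖ₑ ^ 2 := by
    rw [lintegral_const_mul _ (by fun_prop), enorm_sq_Lp_two g,
      lintegral_sub_left_eq_self (fun x => ‖g x‖ₑ ^ 2)]
  simp only [hinner]
  rw [lintegral_mul_const _ (by fun_prop), enorm_sq_Lp_two f]

theorem ae_memLp_mul_conj_translate (g f : L2) :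
    ∀ᵐ x : ℝ, MemLp (fun t => f t * conj (g (t - x))) 2 volume := by
  have hfin : ∫⁻ x : ℝ, ∫⁻ t : ℝ, ‖f t * conj (g (t - x))‖ₑ ^ 2 ≠ ∞ := by
    rw [lintegral_lintegral_enorm_sq_mul_conj_translate]
    finiteness
  have hmeas : Measurable fun x : ℝ => ∫⁻ t : ℝ, ‖f t * conj (g (t - x))‖ₑ ^ 2 :=
    .lintegral_prod_right' (f := fun p : ℝ × ℝ => ‖f p.2 * conj (g (p.2 - p.1))‖ₑ ^ 2) <| by
      simp only [enorm_mul, RCLike.enorm_conj]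
      fun_prop
  filter_upwards [ae_lt_top hmeas hfin] with x hx
  refine ⟨(integrable_mul_conj_translate g f x).aestronglyMeasurable, ?_⟩
  rw [eLpNorm_lt_top_iff_lintegral_rpow_enorm_lt_top two_ne_zero ENNReal.ofNat_ne_top]
  simpa using hx

/-- Moyal's identity. -/
theorem lintegral_enorm_sq_stft (g f : L2) :
    ∫⁻ z : ℂ, ‖stft g f z‖ₑ ^ 2 = ‖f‖ₑ ^ 2 * ‖g‖ₑ ^ 2 := by
  have hmeas : Measurable fun p : ℝ × ℝ => ‖stft g f ⟨p.1, p.2⟩‖ₑ ^ 2 := by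
    have := (continuous_stft g f).measurable
    exact (this.comp Complex.measurableEquivRealProd.symm.measurable).enorm.pow_const 2
  calc ∫⁻ z : ℂ, ‖stft g f z‖ₑ ^ 2
    _ = ∫⁻ p : ℝ × ℝ, ‖stft g f ⟨p.1, p.2⟩‖ₑ ^ 2 :=
        (Complex.volume_preserving_equiv_real_prod.symm.lintegral_comp_emb
          Complex.measurableEquivRealProd.symm.measurableEmbedding _).symm
    _ = ∫⁻ x : ℝ, ∫⁻ ξ : ℝ, ‖𝓕 (fun t => f t * conj (g (t - x))) ξ‖ₑ ^ 2 := by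
        rw [Measure.volume_eq_prod, lintegral_prod _ hmeas.aemeasurable]
        simp only [stft_eq_fourier]
    _ = ∫⁻ x : ℝ, ∫⁻ t : ℝ, ‖f t * conj (g (t - x))‖ₑ ^ 2 :=
        lintegral_congr_ae <| (ae_memLp_mul_conj_translate g f).mono fun x hx =>
          lintegral_enorm_sq_fourier (integrable_mul_conj_translate g f x) hx
    _ = ‖f‖ₑ ^ 2 * ‖g‖ₑ ^ 2 := lintegral_lintegral_enorm_sq_mul_conj_translate g f

end Moyal

section LatticeCells

variable {a b : ℝ}

theorem min_le_dist_latticePoint (ha : 0 ≤ a) (hb : 0 ≤ b) {p q : ℤ × ℤ} (hpq : p ≠ q) :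
    min a b ≤ dist (latticePoint a b p) (latticePoint a b q) := by
  have hone {m n : ℤ} (hmn : m ≠ n) : (1 : ℝ) ≤ |m - n| := by
    exact_mod_cast Int.one_le_abs (sub_ne_zero.2 hmn)
  rw [dist_eq_norm]
  rcases eq_or_ne p.1 q.1 with h₁ | h₁
  · have h₂ : p.2 ≠ q.2 := fun h => hpq (Prod.ext h₁ h)
    refine (min_le_right a b).trans (le_trans ?_ (Complex.abs_im_le_norm _))
    simpa [latticePoint, ← mul_sub, abs_mul, abs_of_nonneg hb] using
      le_mul_of_one_le_right hb (hone h₂)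
  · refine (min_le_left a b).trans (le_trans ?_ (Complex.abs_re_le_norm _))
    simpa [latticePoint, ← mul_sub, abs_mul, abs_of_nonneg ha] using
      le_mul_of_one_le_right ha (hone h₁)

theorem latticePoint_injective (ha : 0 < a) (hb : 0 < b) :
    Function.Injective (latticePoint a b) := fun p q hpq => by
  by_contra hne
  have hle := min_le_dist_latticePoint ha.le hb.le hne
  rw [hpq, dist_self] at hle
  exact hle.not_gt (lt_min ha hb)

theorem isRelativelyUniformlySeparated_range_latticePoint (ha : 0 < a) (hb : 0 < b) :
    IsRelativelyUniformlySeparated (Set.range (latticePoint a b)) := by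
  refine ⟨1, fun _ => Set.range (latticePoint a b), fun _ => ⟨min a b, lt_min ha hb, ?_⟩,
    (Set.iUnion_const _).symm⟩
  rintro _ ⟨p, rfl⟩ _ ⟨q, rfl⟩ hpq
  exact min_le_dist_latticePoint ha.le hb.le (ne_of_apply_ne _ hpq)

theorem IsGaborBessel.isBessel_gaborSystem {g : L2}
    (hg : IsGaborBessel g (Set.range (latticePoint a b))) (ha : 0 < a) (hb : 0 < b) :
    IsBessel ℂ (gaborSystem a b g) := by
  obtain ⟨B, -, hle⟩ := hg
  refine ⟨B.toNNReal, fun f => ?_⟩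
  calc ∑' p, ‖⟪gaborSystem a b g p, f⟫_ℂ‖ₑ ^ 2
    _ = ∑' z : Set.range (latticePoint a b), ‖stft g f z‖ₑ ^ 2 := by
        simp only [gaborSystem, ← stft_eq_inner]
        exact (Equiv.ofInjective _ (latticePoint_injective ha hb)).tsum_eq
          (fun z : Set.range (latticePoint a b) => ‖stft g f z‖ₑ ^ 2)
    _ ≤ B.toNNReal * ‖f‖ₑ ^ 2 := by
        simpa only [ENNReal.ofReal_mul' (sq_nonneg ‖f‖), ENNReal.ofReal_pow (norm_nonneg f),
          ofReal_norm] using! hle f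

/-- The closed square of side length `r` whose lower left corner is `z`. -/
def cell (z : ℂ) (r : ℝ) : Set ℂ := Set.Icc z.re (z.re + r) ×ℂ Set.Icc z.im (z.im + r)

theorem measurableSet_cell (z : ℂ) (r : ℝ) : MeasurableSet (cell z r) :=
  (Complex.measurable_re measurableSet_Icc).inter (Complex.measurable_im measurableSet_Icc)

theorem volume_cell (z : ℂ) {r : ℝ} (hr : 0 ≤ r) : volume (cell z r) = ENNReal.ofReal (r ^ 2) := by
  have h := Complex.volume_preserving_equiv_real_prod.measure_preimage
    (s := Set.Icc z.re (z.re + r) ×ˢ Set.Icc z.im (z.im + r))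
    (measurableSet_Icc.prod measurableSet_Icc).nullMeasurableSet
  rw [Measure.volume_eq_prod, Measure.prod_prod, Real.volume_Icc, Real.volume_Icc,
    add_sub_cancel_left, add_sub_cancel_left, ← ENNReal.ofReal_mul hr, ← sq] at h
  exact h

theorem measureReal_cell (z : ℂ) {r : ℝ} (hr : 0 ≤ r) : volume.real (cell z r) = r ^ 2 := by
  rw [measureReal_def, volume_cell z hr, ENNReal.toReal_ofReal (sq_nonneg r)]

theorem preimage_add_cell (z : ℂ) (r : ℝ) : (z + ·) ⁻¹' cell z r = cell 0 r := by
  ext w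
  simp [cell, Complex.mem_reProdIm]

theorem image_add_square (z : ℂ) (R : ℝ) :
    (z + ·) '' square R = cell (z - ⟨R / 2, R / 2⟩) R := by
  ext w
  rw [Set.image_add_left, Set.mem_preimage, square, Set.mem_ofPred_eq, max_le_iff, abs_le, abs_le,
    cell, Complex.mem_reProdIm, Set.mem_Icc, Set.mem_Icc]
  simp only [Complex.add_re, Complex.add_im, Complex.neg_re, Complex.neg_im, Complex.sub_re,
    Complex.sub_im]
  constructor <;> rintro ⟨⟨_, _⟩, _, _⟩ <;> refine ⟨⟨?_, ?_⟩, ?_, ?_⟩ <;> linarith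

/-- The union of the squares of side length `r` whose lower left corners form the lattice
`aℤ + ibℤ`. -/
def latticeCells (a b r : ℝ) : Set ℂ := ⋃ p, cell (latticePoint a b p) r

theorem measurableSet_latticeCells (a b r : ℝ) : MeasurableSet (latticeCells a b r) :=
  .iUnion fun _ => measurableSet_cell _ r

theorem exists_cell_latticePoint_subset (ha : 0 < a) (hb : 0 < b) {r R : ℝ} (har : a + r ≤ R)
    (hbr : b + r ≤ R) (z : ℂ) : ∃ p, cell (latticePoint a b p) r ⊆ cell z R := by
  have hceil {c : ℝ} (hc : 0 < c) (s : ℝ) : s ≤ c * ⌈s / c⌉ ∧ c * ⌈s / c⌉ ≤ s + c := by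
    constructor
    · rw [← div_le_iff₀' hc]
      exact Int.le_ceil _
    · have := (mul_lt_mul_iff_right₀ hc).2 (Int.ceil_lt_add_one (s / c))
      rw [mul_add, mul_div_cancel₀ _ hc.ne', mul_one] at this
      exact this.le
  have hre := hceil ha z.re
  have him := hceil hb z.im
  refine ⟨(⌈z.re / a⌉, ⌈z.im / b⌉), ?_⟩
  exact Set.inter_subset_inter
    (Set.preimage_mono (Set.Icc_subset_Icc hre.1 (by dsimp only [latticePoint]; linarith)))
    (Set.preimage_mono (Set.Icc_subset_Icc him.1 (by dsimp only [latticePoint]; linarith)))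

theorem finite_latticePoint_preimage_cell (ha : 0 < a) (hb : 0 < b) (z : ℂ) (R : ℝ) :
    (latticePoint a b ⁻¹' cell z R).Finite := by
  refine ((Set.finite_Icc ⌈z.re / a⌉ ⌊(z.re + R) / a⌋).prod
    (Set.finite_Icc ⌈z.im / b⌉ ⌊(z.im + R) / b⌋)).subset ?_
  rintro p ⟨⟨h₁, h₂⟩, h₃, h₄⟩
  exact ⟨⟨Int.ceil_le.2 ((div_le_iff₀' ha).2 h₁), Int.le_floor.2 ((le_div_iff₀' ha).2 h₂)⟩,
    Int.ceil_le.2 ((div_le_iff₀' hb).2 h₃), Int.le_floor.2 ((le_div_iff₀' hb).2 h₄)⟩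

theorem exists_measureReal_latticeCells_inter_cell_le (ha : 0 < a) (hb : 0 < b) (z : ℂ) (R : ℝ) :
    ∃ N : ℕ, ∀ r, 0 ≤ r → r ≤ 1 → volume.real (latticeCells a b r ∩ cell z R) ≤ N * r ^ 2 := by
  have hfin := finite_latticePoint_preimage_cell ha hb (z - ⟨1, 1⟩) (R + 1)
  refine ⟨hfin.toFinset.card, fun r hr hr₁ => ?_⟩
  have hsub : latticeCells a b r ∩ cell z R ⊆
      ⋃ p ∈ hfin.toFinset, cell (latticePoint a b p) r := by
    rintro w ⟨hw, ⟨hz₁, hz₂⟩, hz₃, hz₄⟩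
    obtain ⟨p, hp⟩ := Set.mem_iUnion.1 hw
    have ⟨⟨hp₁, hp₂⟩, hp₃, hp₄⟩ := hp
    refine Set.mem_biUnion (hfin.mem_toFinset.2 ?_) hp
    refine ⟨⟨?_, ?_⟩, ?_, ?_⟩ <;> simp only [Complex.sub_re, Complex.sub_im] <;> linarith
  calc volume.real (latticeCells a b r ∩ cell z R)
    _ ≤ ∑ p ∈ hfin.toFinset, volume.real (cell (latticePoint a b p) r) := by
        refine (measureReal_mono hsub ?_).trans (measureReal_biUnion_finset_le _ _)
        exact (measure_biUnion_lt_top hfin.toFinset.finite_toSet fun p _ =>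
          by simp [volume_cell _ hr]).ne
    _ = hfin.toFinset.card * r ^ 2 := by simp [measureReal_cell _ hr]

/-- The lower density `inf_z |Ω ∩ (z + Q_R)| / R²` of `Ω` at scale `R`, so that the measurable sets
of positive lower density `γ` are the `(γ, R)`-dense sets. -/
def lowerDensity (R : ℝ) (Ω : Set ℂ) : ℝ :=
  ⨅ z : ℂ, volume.real (Ω ∩ (fun w => z + w) '' square R) / R ^ 2

theorem lowerDensity_nonneg (R : ℝ) (Ω : Set ℂ) : 0 ≤ lowerDensity R Ω :=
  Real.iInf_nonneg fun _ => by positivity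

theorem sq_div_sq_le_lowerDensity_latticeCells (ha : 0 < a) (hb : 0 < b) {r R : ℝ} (hr : 0 ≤ r)
    (har : a + r ≤ R) (hbr : b + r ≤ R) : r ^ 2 / R ^ 2 ≤ lowerDensity R (latticeCells a b r) := by
  have hR : 0 ≤ R := by linarith
  refine le_ciInf fun z => ?_
  rw [image_add_square]
  obtain ⟨p, hp⟩ := exists_cell_latticePoint_subset ha hb har hbr (z - ⟨R / 2, R / 2⟩)
  gcongr
  rw [← measureReal_cell (latticePoint a b p) hr]
  have hcell : cell (latticePoint a b p) r ⊆ latticeCells a b r :=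
    Set.subset_iUnion_of_subset p le_rfl
  refine measureReal_mono (Set.subset_inter hcell hp) ?_
  exact measure_ne_top_of_subset Set.inter_subset_right (by simp [volume_cell _ hR])

theorem eventually_sq_div_sq_le_lowerDensity_latticeCells (ha : 0 < a) (hb : 0 < b) {R : ℝ}
    (haR : a < R) (hbR : b < R) :
    ∀ᶠ r in 𝓝[>] 0, r ^ 2 / R ^ 2 ≤ lowerDensity R (latticeCells a b r) := by
  filter_upwards [Ioo_mem_nhdsGT (lt_min (sub_pos.2 haR) (sub_pos.2 hbR))] with r ⟨hr, hlt⟩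
  obtain ⟨hra, hrb⟩ := lt_min_iff.1 hlt
  exact sq_div_sq_le_lowerDensity_latticeCells ha hb hr.le (lt_sub_iff_add_lt'.1 hra).le
    (lt_sub_iff_add_lt'.1 hrb).le

theorem tendsto_lowerDensity_latticeCells (ha : 0 < a) (hb : 0 < b) (R : ℝ) :
    Tendsto (fun r => lowerDensity R (latticeCells a b r)) (𝓝[>] 0) (𝓝 0) := by
  obtain ⟨N, hN⟩ := exists_measureReal_latticeCells_inter_cell_le ha hb (0 - ⟨R / 2, R / 2⟩) R
  have hlim : Tendsto (fun r : ℝ => N * r ^ 2 / R ^ 2) (𝓝[>] 0) (𝓝 0) := by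
    have hcont : Continuous fun r : ℝ => N * r ^ 2 / R ^ 2 := by fun_prop
    simpa using (hcont.tendsto 0).mono_left nhdsWithin_le_nhds
  refine tendsto_of_tendsto_of_tendsto_of_le_of_le' tendsto_const_nhds hlim
    (.of_forall fun r => lowerDensity_nonneg R _) ?_
  filter_upwards [Ioc_mem_nhdsGT one_pos] with r hr
  refine (ciInf_le ⟨0, ?_⟩ 0).trans ?_
  · rintro _ ⟨z, rfl⟩
    positivity
  · rw [image_add_square]
    gcongr
    exact hN r hr.1.le hr.2

end LatticeCells

section SamplingConstants

variable {a b : ℝ} {g : L2}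

theorem lintegral_latticeCells_le (hB : IsBessel ℂ (gaborSystem a b g)) (f : L2) (r : ℝ) :
    ∫⁻ z in latticeCells a b r, ‖stft g f z‖ₑ ^ 2 ≤
      ∫⁻ w in cell 0 r, ‖hB.analysis (shiftL2 (-w) f)‖ₑ ^ 2 := by
  have hmeas : Measurable fun z => ‖stft g f z‖ₑ ^ 2 :=
    (continuous_stft g f).measurable.enorm.pow_const 2
  calc ∫⁻ z in latticeCells a b r, ‖stft g f z‖ₑ ^ 2
    _ ≤ ∑' p, ∫⁻ z in cell (latticePoint a b p) r, ‖stft g f z‖ₑ ^ 2 := lintegral_iUnion_le _ _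
    _ = ∑' p, ∫⁻ w in cell 0 r, ‖stft g f (latticePoint a b p + w)‖ₑ ^ 2 :=
        tsum_congr fun p => by
          rw [← preimage_add_cell (latticePoint a b p),
            (measurePreserving_add_left volume _).setLIntegral_comp_preimage
              (measurableSet_cell _ r) hmeas]
    _ = ∫⁻ w in cell 0 r, ∑' p, ‖stft g f (latticePoint a b p + w)‖ₑ ^ 2 :=
        (lintegral_tsum fun p => (hmeas.comp (measurable_const_add _)).aemeasurable).symm
    _ = ∫⁻ w in cell 0 r, ‖hB.analysis (shiftL2 (-w) f)‖ₑ ^ 2 := by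
        simp only [enorm_stft_add, hB.enorm_sq_analysis, gaborSystem]

theorem exists_norm_sq_analysis_lt (hB : IsBessel ℂ (gaborSystem a b g)) (ha : 0 < a) (hb : 0 < b)
    (hab : 1 < a * b) {A : ℝ} (hA : 0 < A) : ∃ f, ‖hB.analysis f‖ ^ 2 < A * ‖f‖ ^ 2 := by
  by_contra! hlow
  exact hab.not_ge (mul_le_one_of_lower_frame_bound hB ha hb hA hlow)

theorem eventually_forall_mem_cell {P : ℂ → Prop} (hP : ∀ᶠ w in 𝓝 0, P w) :
    ∀ᶠ r in 𝓝[>] 0, ∀ w ∈ cell 0 r, P w := by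
  obtain ⟨η, hη, hball⟩ := Metric.eventually_nhds_iff.1 hP
  filter_upwards [Ioo_mem_nhdsGT (half_pos hη)] with r ⟨_, hr⟩ w ⟨⟨hre, hre'⟩, him, him'⟩
  simp only [Complex.zero_re, Complex.zero_im, zero_add] at hre hre' him him'
  refine hball ((dist_zero_right w).trans_lt ((Complex.norm_le_abs_re_add_abs_im w).trans_lt ?_))
  rw [abs_of_nonneg hre, abs_of_nonneg him]
  linarith

theorem eventually_lintegral_latticeCells_le (hB : IsBessel ℂ (gaborSystem a b g)) {f : L2} {c : ℝ}
    (hf : ‖hB.analysis f‖ ^ 2 < c) :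
    ∀ᶠ r in 𝓝[>] 0, ∫⁻ z in latticeCells a b r, ‖stft g f z‖ₑ ^ 2 ≤ ENNReal.ofReal (c * r ^ 2) := by
  have hcont : Continuous fun w : ℂ => ‖hB.analysis (shiftL2 (-w) f)‖ ^ 2 :=
    (hB.analysis.continuous.comp ((continuous_shiftL2 f).comp continuous_neg)).norm.pow 2
  have hnear : ∀ᶠ w in 𝓝 (0 : ℂ), ‖hB.analysis (shiftL2 (-w) f)‖ ^ 2 < c :=
    hcont.continuousAt.eventually_lt_const (by simpa [shiftL2_zero] using hf)
  filter_upwards [eventually_forall_mem_cell hnear, self_mem_nhdsWithin] with r hcell hr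
  calc ∫⁻ z in latticeCells a b r, ‖stft g f z‖ₑ ^ 2
    _ ≤ ∫⁻ w in cell 0 r, ‖hB.analysis (shiftL2 (-w) f)‖ₑ ^ 2 := lintegral_latticeCells_le hB f r
    _ ≤ ∫⁻ _ in cell 0 r, ENNReal.ofReal c :=
        setLIntegral_mono measurable_const fun w hw => by
          rw [← ofReal_norm, ← ENNReal.ofReal_pow (norm_nonneg _)]
          exact ENNReal.ofReal_le_ofReal (hcell w hw).le
    _ = ENNReal.ofReal (c * r ^ 2) := by
        rw [setLIntegral_const, volume_cell 0 (le_of_lt hr), ENNReal.ofReal_mul' (sq_nonneg r)]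

theorem eventually_forall_isSamplingBound_latticeCells (hg : g ≠ 0)
    (hB : IsBessel ℂ (gaborSystem a b g)) (ha : 0 < a) (hb : 0 < b) (hab : 1 < a * b) {K : ℝ}
    (hK : 0 < K) :
    ∀ᶠ r in 𝓝[>] 0, ∀ C, 0 < C → IsSamplingBound g (latticeCells a b r) C → K ≤ C * r ^ 2 := by
  have : 0 < ‖g‖ := norm_pos_iff.2 hg
  obtain ⟨f, hf⟩ := exists_norm_sq_analysis_lt hB ha hb hab (A := ‖g‖ ^ 2 / K) (by positivity)
  have hf_pos : 0 < ‖f‖ ^ 2 :=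
    pos_of_mul_pos_right ((sq_nonneg _).trans_lt hf) (by positivity)
  filter_upwards [eventually_lintegral_latticeCells_le hB hf] with r hr C hC hbound
  have hle : ‖f‖ ^ 2 * ‖g‖ ^ 2 ≤ C * (‖g‖ ^ 2 / K * ‖f‖ ^ 2 * r ^ 2) := by
    rw [← ENNReal.ofReal_le_ofReal_iff (by positivity), ENNReal.ofReal_mul hC.le,
      ENNReal.ofReal_mul (sq_nonneg _), ENNReal.ofReal_pow (norm_nonneg _),
      ENNReal.ofReal_pow (norm_nonneg _), ofReal_norm, ofReal_norm, ← lintegral_enorm_sq_stft]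
    exact (hbound f).trans (mul_le_mul_right hr _)
  have hfactor : C * (‖g‖ ^ 2 / K * ‖f‖ ^ 2 * r ^ 2) = ‖f‖ ^ 2 * ‖g‖ ^ 2 * (C * r ^ 2 / K) := by
    ring
  rw [hfactor, le_mul_iff_one_le_right (by positivity), one_le_div hK] at hle
  exact hle

theorem exists_lt_samplingConstant (hg : g ≠ 0) (hB : IsBessel ℂ (gaborSystem a b g)) (ha : 0 < a)
    (hb : 0 < b) (hab : 1 < a * b) {R : ℝ} (haR : a < R) (hbR : b < R)
    (hS : ∀ γ Ω, IsGammaDense γ R Ω → IsPlanarSamplingSet g Ω) {K δ : ℝ} (hK : 0 < K)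
    (hδ : 0 < δ) :
    ∃ γ Ω, γ < δ ∧ IsGammaDense γ R Ω ∧ K * γ⁻¹ < samplingConstant g Ω := by
  have hR : 0 < R := ha.trans haR
  have hbounds := eventually_forall_isSamplingBound_latticeCells hg hB ha hb hab
    (K := 2 * K * R ^ 2) (by positivity)
  have hdensity := eventually_sq_div_sq_le_lowerDensity_latticeCells ha hb haR hbR
  have hsmall := (tendsto_lowerDensity_latticeCells ha hb R).eventually_lt_const hδ
  obtain ⟨r, hr, hC, hle, hlt⟩ :=
    (eventually_mem_nhdsWithin.and (hbounds.and (hdensity.and hsmall))).exists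
  have hr₀ : 0 < r ^ 2 := pow_pos hr 2
  have hdense : IsGammaDense (lowerDensity R (latticeCells a b r)) R (latticeCells a b r) :=
    ⟨measurableSet_latticeCells a b r, rfl, (by positivity : 0 < r ^ 2 / R ^ 2).trans_le hle⟩
  refine ⟨_, _, hlt, hdense, ?_⟩
  calc K * (lowerDensity R (latticeCells a b r))⁻¹
    _ ≤ K * (r ^ 2 / R ^ 2)⁻¹ := by gcongr
    _ = K * R ^ 2 / r ^ 2 := by rw [inv_div, mul_div_assoc]
    _ < 2 * K * R ^ 2 / r ^ 2 := by gcongr; linarith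
    _ ≤ samplingConstant g (latticeCells a b r) :=
        le_csInf (hS _ _ hdense) fun C hC' => (div_le_iff₀ hr₀).2 (hC C hC'.1 hC'.2)

theorem exists_pos_mul_rpow_le {K γ C : ℝ} (hγ : 0 < γ) (hC : K * γ⁻¹ < C) :
    ∃ ε : ℝ, 0 < ε ∧ K * γ ^ (-1 - ε) ≤ C := by
  have hcont : Continuous fun ε : ℝ => K * γ ^ (-1 - ε) :=
    continuous_const.mul ((Real.continuous_const_rpow hγ.ne').comp (by fun_prop))
  have hlt : ∀ᶠ ε in 𝓝[>] (0 : ℝ), K * γ ^ (-1 - ε) < C :=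
    (hcont.continuousAt.eventually_lt_const
      (by simpa [Real.rpow_neg_one] using hC)).filter_mono nhdsWithin_le_nhds
  obtain ⟨ε, hε, hle⟩ := (eventually_mem_nhdsWithin.and hlt).exists
  exact ⟨ε, hε, hle.le⟩

end SamplingConstants

end PlanarSampling

end

open PlanarSampling in
theorem mainTheorem7_general {g : L2} (hg : g ≠ 0) {a b R : ℝ} (ha : 0 < a) (hb : 0 < b)
    (hab : 1 < a * b) (haR : a < R) (hbR : b < R)
    (hB : IsGaborBessel g (Set.range (latticePoint a b)))
    (hS : ∀ (γ : ℝ) (Ω : Set ℂ), IsGammaDense γ R Ω → IsPlanarSamplingSet g Ω) :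
    (¬ ∃ K : ℝ, 0 < K ∧ ∀ (γ : ℝ) (Ω : Set ℂ), IsGammaDense γ R Ω →
      samplingConstant g Ω ≤ K * γ⁻¹) ∧
    (∀ K δ : ℝ, 0 < K → 0 < δ → ∃ (γ : ℝ) (Ω : Set ℂ), γ < δ ∧ IsGammaDense γ R Ω ∧
      ∃ ε : ℝ, 0 < ε ∧ K * γ ^ (-1 - ε) ≤ samplingConstant g Ω) := by
  have hlarge {K δ : ℝ} (hK : 0 < K) (hδ : 0 < δ) :=
    exists_lt_samplingConstant hg (hB.isBessel_gaborSystem ha hb) ha hb hab haR hbR hS hK hδ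
  constructor
  · rintro ⟨K, hK, hle⟩
    obtain ⟨γ, Ω, -, hΩ, hlt⟩ := hlarge hK one_pos
    exact hlt.not_ge (hle γ Ω hΩ)
  · intro K δ hK hδ
    obtain ⟨γ, Ω, hγ, hΩ, hlt⟩ := hlarge hK hδ
    exact ⟨γ, Ω, hγ, hΩ, exists_pos_mul_rpow_le hΩ.2.2 hlt⟩

theorem mainTheorem7 (g : PlanarSampling.L2) (hg : g ≠ 0)
    (hB : ∀ Γ : Set ℂ, PlanarSampling.IsRelativelyUniformlySeparated Γ →
      PlanarSampling.IsGaborBessel g Γ)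
    (R : ℝ) (hR : 2 < R)
    (hS : ∀ (γ : ℝ) (Ω : Set ℂ), PlanarSampling.IsGammaDense γ R Ω →
      PlanarSampling.IsPlanarSamplingSet g Ω) :
    (¬ ∃ K : ℝ, 0 < K ∧ ∀ (γ : ℝ) (Ω : Set ℂ), PlanarSampling.IsGammaDense γ R Ω →
      PlanarSampling.samplingConstant g Ω ≤ K * γ⁻¹) ∧
    (∀ K δ : ℝ, 0 < K → 0 < δ → ∃ (γ : ℝ) (Ω : Set ℂ), γ < δ ∧
      PlanarSampling.IsGammaDense γ R Ω ∧
      ∃ ε : ℝ, 0 < ε ∧ K * γ ^ (-1 - ε) ≤ PlanarSampling.samplingConstant g Ω) :=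
  mainTheorem7_general hg two_pos one_pos (by norm_num) hR (one_lt_two.trans hR)
    (hB _ (PlanarSampling.isRelativelyUniformlySeparated_range_latticePoint two_pos one_pos)) hS
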